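/- Let $m\ge 1$ and let $\mathbb{R}_m$ be the real Clifford algebra generated by the standard basis $e_1,\dots,e_m$ of $\mathbb{R}^m$ with $e_j^2=-1$ and $e_ie_j=-e_je_i$ for $i\ne j$; a point $x=(x_1,\dots,x_m)\in\mathbb{R}^m$ is identified with the Clifford vector $x=\sum_{j=1}^m x_je_j\in\mathbb{R}_m$, and $|x|$ is its Euclidean norm. Let $\partial_x f=\sum_{j=1}^m e_j\,\partial_{x_j}f$ be the Dirac operator. For an integer $k\ge 0$ let $Y_k:\mathbb{R}^m\to\mathbb{R}_m$ be a left solid inner spherical monogenic of order $k$, that is, an $\mathbb{R}_m$-valued homogeneous polynomial of degree $k$ with $\partial_xY_k=0$ on $\mathbb{R}^m$. For $\alpha>-1$ and an integer $n\ge 0$ the Clifford-Gegenbauer polynomial is defined on the open unit ball $|x|<1$ by $$C_{n,m}^{\alpha}(Y_k)(x)=(1-|x|^2)^{-\alpha}\,\partial_x^{\,n}\big((1-|x|^2)^{\alpha+n}\,Y_k(x)\big).$$ Let $N\ge 0$ be an integer and $\mu=k+\frac m2$. Then for every $x\in\mathbb{R}^m$ with $|x|<1$: $$C_{2N,m}^{\alpha}(Y_k)(x)=\frac{2^{2N}\,\Gamma(\alpha+2N+1)\,\Gamma(\mu+N)}{\Gamma(\alpha+N+1)\,\Gamma(\mu+N+\alpha)}\sum_{l=0}^{N}\binom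 Nl\frac{\Gamma(l+\mu+N+\alpha)}{\Gamma(l+\mu)}(-1)^l|x|^{2l}\,Y_k(x),$$ provided $\mu+N+\alpha\neq 0$ (this only excludes the case $m=1$, $k=N=0$, $\alpha=-\tfrac12$, in which the right-hand side contains $\Gamma(0)$), and $$C_{2N+1,m}^{\alpha}(Y_k)(x)=-\frac{2^{2N+1}\,\Gamma(\alpha+2N+2)\,\Gamma(\mu+N+1)}{\Gamma(\alpha+N+1)\,\Gamma(\mu+N+\alpha+1)}\sum_{l=0}^{N}\binom Nl\frac{\Gamma(l+\mu+N+1+\alpha)}{\Gamma(l+\mu+1)}(-1)^l|x|^{2l}\,x\,Y_k(x).$$ -/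

import Mathlib

namespace CliffordGegenbauer

/-- The quadratic form `v ↦ -|v|²` on Euclidean space `ℝ^m`. -/
noncomputable def negForm (m : ℕ) : QuadraticForm ℝ (EuclideanSpace ℝ (Fin m)) :=
  -(LinearMap.BilinMap.toQuadraticMap (innerₗ (EuclideanSpace ℝ (Fin m))))

theorem negForm_apply {m : ℕ} (v : EuclideanSpace ℝ (Fin m)) : negForm m v = -‖v‖ ^ 2 := by
  simp [negForm]

/-- The real Clifford algebra `ℝ_m`, in which `e_j² = -1` and `e_i e_j = -e_j e_i` for `i ≠ j`. -/
abbrev RealClifford (m : ℕ) : Type := CliffordAlgebra (negForm m)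

/-- The identification of the point `x` with the Clifford vector `∑ j, x_j e_j`. -/
noncomputable def vec {m : ℕ} (x : EuclideanSpace ℝ (Fin m)) : RealClifford m :=
  CliffordAlgebra.ι (negForm m) x

/-- The standard orthonormal basis vector `e_j`, as a point of `ℝ^m`. -/
noncomputable def stdVec {m : ℕ} (j : Fin m) : EuclideanSpace ℝ (Fin m) :=
  EuclideanSpace.single j 1

/-- The generator `e_j` of the Clifford algebra. -/
noncomputable def gen {m : ℕ} (j : Fin m) : RealClifford m := vec (stdVec j)

theorem vec_mul_self {m : ℕ} (x : EuclideanSpace ℝ (Fin m)) :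
    vec x * vec x = algebraMap ℝ (RealClifford m) (-‖x‖ ^ 2) := by
  rw [vec, CliffordAlgebra.ι_sq_scalar, negForm_apply]

theorem gen_mul_self {m : ℕ} (j : Fin m) : gen j * gen j = (-1 : RealClifford m) := by
  simp [gen, vec_mul_self, stdVec]

theorem gen_mul_gen {m : ℕ} {i j : Fin m} (h : i ≠ j) :
    gen j * gen i = -(gen i * gen j : RealClifford m) := by
  rw [eq_neg_iff_add_eq_zero, gen, gen, vec, vec, CliffordAlgebra.ι_mul_ι_add_swap]
  simp [QuadraticMap.polar, negForm_apply, norm_add_sq_real, stdVec, EuclideanSpace.inner_single_left,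
    h]

theorem vec_eq_sum {m : ℕ} (x : EuclideanSpace ℝ (Fin m)) : vec x = ∑ j, x j • gen j := by
  have hx : x = ∑ j, x j • stdVec j := by
    ext i
    simp [stdVec, Finset.sum_apply, Pi.single_apply]
  conv_lhs => rw [hx]
  simp only [vec, gen, map_sum, map_smul]

/-- The basis `(e_A)` of `ℝ_m`, indexed by the subsets `A ⊆ {1, …, m}`; see `basisA_apply`. -/
noncomputable def basisA (m : ℕ) : Module.Basis (Finset (Fin m)) ℝ (RealClifford m) :=
  ((EuclideanSpace.basisFun (Fin m) ℝ).toBasis.ExteriorAlgebra).map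
    (CliffordAlgebra.equivExterior (negForm m)).symm

theorem equivExterior_prod {m : ℕ} (l : List (Fin m)) (hl : l.Nodup) :
    CliffordAlgebra.equivExterior (negForm m) (l.map gen).prod =
      (l.map fun j => ExteriorAlgebra.ι ℝ (stdVec j)).prod := by
  have key : ∀ (a : Fin m) (l : List (Fin m)), a ∉ l →
      CliffordAlgebra.contractLeft
        ((QuadraticMap.associated (R := ℝ) (-negForm m)) (stdVec a))
        ((l.map fun j => CliffordAlgebra.ι (0 : QuadraticForm ℝ (EuclideanSpace ℝ (Fin m)))
          (stdVec j)).prod) = 0 := by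
    intro a l
    induction l with
    | nil => simp
    | cons b l ih =>
      intro h
      simp only [List.mem_cons, not_or] at h
      rw [List.map_cons, List.prod_cons, CliffordAlgebra.contractLeft_ι_mul, ih h.2]
      simp [QuadraticMap.associated_apply, negForm_apply, norm_add_sq_real, stdVec,
        EuclideanSpace.inner_single_left, h.1]
  induction l with
  | nil => simp
  | cons a l ih =>
    rw [List.nodup_cons] at hl
    have ih := ih hl.2
    simp only [CliffordAlgebra.equivExterior, CliffordAlgebra.changeFormEquiv_apply] at ih ⊢
    rw [List.map_cons, List.prod_cons, gen, vec, CliffordAlgebra.changeForm_ι_mul, ih,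
      List.map_cons, List.prod_cons]
    exact (congrArg _ (key a l hl.1)).trans (sub_zero _)

/-- `e_A = e_{j_1} ⋯ e_{j_h}` for `A = {j_1 < ⋯ < j_h}`. -/
theorem basisA_apply {m : ℕ} (A : Finset (Fin m)) :
    basisA m A = ((A.sort (· ≤ ·)).map gen).prod := by
  rw [basisA, Module.Basis.map_apply, LinearEquiv.symm_apply_eq,
    equivExterior_prod _ (A.sort_nodup _), ExteriorAlgebra.basis_apply_ofCard _ rfl,
    ExteriorAlgebra.ιMulti_family, ExteriorAlgebra.ιMulti_apply, ← Finset.listMap_orderEmbOfFin_finRange A rfl, List.map_map,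
    List.ofFn_eq_map]
  congr 1
  refine List.map_congr_left fun i _ => ?_
  simp only [Function.comp_apply, Set.powersetCard.ofFinEmbEquiv_symm_apply]
  simp [stdVec]

/-- The coordinates of a Clifford number with respect to the basis `(e_A)`. -/
noncomputable def coords (m : ℕ) : RealClifford m ≃ₗ[ℝ] EuclideanSpace ℝ (Finset (Fin m)) :=
  (basisA m).equivFun.trans (WithLp.linearEquiv 2 ℝ (Finset (Fin m) → ℝ)).symm

/-- `ℝ_m` carries the norm `|λ|² = ∑_A λ_A²`. -/
noncomputable instance (m : ℕ) : NormedAddCommGroup (RealClifford m) :=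
  NormedAddCommGroup.induced (RealClifford m) (EuclideanSpace ℝ (Finset (Fin m))) (coords m)
    (coords m).injective

noncomputable instance (m : ℕ) : NormedSpace ℝ (RealClifford m) :=
  NormedSpace.induced ℝ (RealClifford m) (EuclideanSpace ℝ (Finset (Fin m))) (coords m)

theorem norm_sq_eq {m : ℕ} (a : RealClifford m) :
    ‖a‖ ^ 2 = ∑ A : Finset (Fin m), ((basisA m).repr a A) ^ 2 := by
  change ‖coords m a‖ ^ 2 = _
  rw [EuclideanSpace.norm_sq_eq]
  simp [coords]

/-- The Dirac operator `∂_x f = ∑ j, e_j ∂_{x_j} f`, for `f : ℝ^m → ℝ_m`. -/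
noncomputable def dirac {m : ℕ} (f : EuclideanSpace ℝ (Fin m) → RealClifford m)
    (x : EuclideanSpace ℝ (Fin m)) : RealClifford m :=
  ∑ j, gen j * lineDeriv ℝ f x (stdVec j)

/-- `Y` is a left solid inner spherical monogenic of order `k`: an `ℝ_m`-valued homogeneous
polynomial of degree `k` on `ℝ^m` with `∂_x Y = 0`. -/
structure IsInnerSphericalMonogenic {m : ℕ} (k : ℕ)
    (Y : EuclideanSpace ℝ (Fin m) → RealClifford m) : Prop where
  homogeneous_polynomial : ∃ c : (Fin m → ℕ) → RealClifford m,
    ∀ x, Y x = ∑ s ∈ Finset.piAntidiag Finset.univ k, (∏ i, x i ^ s i) • c s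
  monogenic : ∀ x, dirac Y x = 0

/-- The Clifford-Gegenbauer polynomial
`C_{n,m}^α(Y)(x) = (1 - |x|²)^{-α} ∂_x^n ((1 - |x|²)^{α+n} Y(x))`, for `x` in the open unit ball. -/
noncomputable def cgp {m : ℕ} (α : ℝ) (n : ℕ)
    (Y : EuclideanSpace ℝ (Fin m) → RealClifford m)
    (x : EuclideanSpace ℝ (Fin m)) : RealClifford m :=
  (1 - ‖x‖ ^ 2) ^ (-α) • (dirac^[n] fun y => (1 - ‖y‖ ^ 2) ^ (α + n) • Y y) x

end CliffordGegenbauer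

open CliffordGegenbauer

namespace CliffordGegenbauer

/-! The weight (1-|x|²)^(α+n+1) equals (1-|x|²)^((α+1)+n), so the innermost n Dirac operators in
C_{n+1}^α produce C_n^{α+1}. This leaves C_{n+1}^α = (1-|x|²)^(-α) ∂((1-|x|²)^(α+1) C_n^{α+1})
(`cgp_succ`).

On radial multiples of Y and of xY this one-step operator acts on a polynomial P in s = |x|²: P·Y
goes to 2((1-s)P' - (α+1)P)·xY, and P·xY goes to -2(s((1-s)P' - (α+1)P) + μ(1-s)P)·Y
(`cgp_succ_of_even`, `cgp_succ_of_odd`). The Gamma sums are carried into one another by these two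
operators (`derivative_gammaPoly_even`, `derivative_gammaPoly_odd`), which is a comparison of
coefficients using Γ(z+1) = zΓ(z). Induction from C_0 = Y concludes. -/

instance (m : ℕ) : FiniteDimensional ℝ (RealClifford m) :=
  Module.Basis.finiteDimensional_of_finite (basisA m)

/-- Clifford multiplication, as a continuous bilinear map. -/
noncomputable def mulCLM (m : ℕ) : RealClifford m →L[ℝ] RealClifford m →L[ℝ] RealClifford m :=
  LinearMap.toContinuousBilinearMap (LinearMap.mul ℝ (RealClifford m))

@[simp] theorem mulCLM_apply {m : ℕ} (a b : RealClifford m) : mulCLM m a b = a * b := rfl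

/-- The embedding of `ℝ^m` into the Clifford algebra, as a continuous linear map. -/
noncomputable def vecCLM (m : ℕ) : EuclideanSpace ℝ (Fin m) →L[ℝ] RealClifford m :=
  LinearMap.toContinuousLinearMap (CliffordAlgebra.ι (negForm m))

@[simp] theorem vecCLM_apply {m : ℕ} (x : EuclideanSpace ℝ (Fin m)) : vecCLM m x = vec x := rfl

/-! ### Leibniz rules for the Dirac operator. -/

variable {m : ℕ} {x : EuclideanSpace ℝ (Fin m)}
  {f g : EuclideanSpace ℝ (Fin m) → RealClifford m}

theorem dirac_congr (h : f =ᶠ[nhds x] g) : dirac f x = dirac g x := by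
  simp only [dirac, h.lineDeriv_eq]

theorem dirac_eq_of_hasFDerivAt {f' : EuclideanSpace ℝ (Fin m) →L[ℝ] RealClifford m}
    (h : HasFDerivAt f f' x) : dirac f x = ∑ j, gen j * f' (stdVec j) :=
  Finset.sum_congr rfl fun j _ => by rw [(h.hasLineDerivAt (stdVec j)).lineDeriv]

/-- The gradient of h(|x|²) is 2h'x, and ∑ e_j x_j reassembles the Clifford vector x. -/
theorem dirac_radial_smul {h : ℝ → ℝ} {h' : ℝ} (hh : HasDerivAt h h' (‖x‖ ^ 2))
    (hf : DifferentiableAt ℝ f x) :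
    dirac (fun y => h (‖y‖ ^ 2) • f y) x =
      (2 * h') • (vec x * f x) + h (‖x‖ ^ 2) • dirac f x := by
  have hφ := hh.comp_hasFDerivAt x (hasStrictFDerivAt_norm_sq x).hasFDerivAt
  have hj : ∀ j, inner ℝ x (stdVec j) = x j := fun j => by
    simp [stdVec, EuclideanSpace.inner_single_right]
  rw [dirac_eq_of_hasFDerivAt hf.hasFDerivAt]
  refine (dirac_eq_of_hasFDerivAt (hφ.smul hf.hasFDerivAt)).trans ?_
  rw [vec_eq_sum, Finset.sum_mul, Finset.smul_sum, Finset.smul_sum, ← Finset.sum_add_distrib]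
  refine Finset.sum_congr rfl fun j _ => ?_
  simp [hj, mul_add, smul_smul, add_comm]
  ring_nf

/-- Polarization of v² = -|v|². -/
theorem gen_mul_vec (j : Fin m) (x : EuclideanSpace ℝ (Fin m)) :
    gen j * vec x = -(vec x * gen j) - (2 * x j) • (1 : RealClifford m) := by
  rw [eq_sub_iff_add_eq, eq_neg_iff_add_eq_zero]
  have h : gen j * vec x + vec x * gen j = algebraMap ℝ (RealClifford m) (-(2 * x j)) := by
    rw [gen, vec, vec, CliffordAlgebra.ι_mul_ι_add_swap]
    congr 1
    simp only [QuadraticMap.polar, negForm_apply, norm_add_sq_real, stdVec,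
      EuclideanSpace.inner_single_left, map_one, one_mul]
    ring
  rw [add_right_comm, h, Algebra.algebraMap_eq_smul_one, ← add_smul]
  simp

theorem sum_smul_stdVec (x : EuclideanSpace ℝ (Fin m)) : ∑ j, x j • stdVec j = x := by
  ext i
  simp [stdVec, Finset.sum_apply, Pi.single_apply]

/-- Each e_j² = -1 contributes -f, hence -m f; anticommuting e_j past x leaves -2∑ x_j ∂_j f, twice
the Euler operator. -/
theorem dirac_vec_mul (hf : DifferentiableAt ℝ f x) :
    dirac (fun y => vec y * f y) x =
      -((m : ℝ) • f x) - vec x * dirac f x - (2 : ℝ) • fderiv ℝ f x x := by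
  have h := (mulCLM m).hasFDerivAt_of_bilinear (vecCLM m).hasFDerivAt hf.hasFDerivAt
  rw [dirac_eq_of_hasFDerivAt hf.hasFDerivAt]
  refine (dirac_eq_of_hasFDerivAt h).trans ?_
  have hx : fderiv ℝ f x x = ∑ j, x j • fderiv ℝ f x (stdVec j) := by
    simp only [← map_smul, ← map_sum, sum_smul_stdVec]
  have hm : -((m : ℝ) • f x) = ∑ _j : Fin m, -f x := by
    simp [← Nat.cast_smul_eq_nsmul ℝ]
  rw [hx, hm, Finset.mul_sum, Finset.smul_sum, ← Finset.sum_sub_distrib, ← Finset.sum_sub_distrib]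
  refine Finset.sum_congr rfl fun j _ => ?_
  have h1 : gen j * (vec (stdVec j) * f x) = -f x := by
    rw [← mul_assoc, ← gen, gen_mul_self, neg_one_mul]
  have h2 : gen j * (vec x * fderiv ℝ f x (stdVec j)) =
      -(vec x * (gen j * fderiv ℝ f x (stdVec j))) -
        (2 : ℝ) • x j • fderiv ℝ f x (stdVec j) := by
    rw [← mul_assoc, gen_mul_vec, sub_mul, neg_mul, mul_assoc, smul_mul_assoc, one_mul, mul_smul]
  change gen j * (vec x * fderiv ℝ f x (stdVec j) + vec (stdVec j) * f x) = _
  rw [mul_add, h1, h2]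
  abel

/-! ### The Dirac operator on radial multiples of Y and xY. -/

namespace IsInnerSphericalMonogenic

variable {k : ℕ} {Y : EuclideanSpace ℝ (Fin m) → RealClifford m}

theorem differentiable (hY : IsInnerSphericalMonogenic k Y) : Differentiable ℝ Y := by
  obtain ⟨c, hc⟩ := hY.homogeneous_polynomial
  rw [funext hc]
  fun_prop

theorem smul_apply (hY : IsInnerSphericalMonogenic k Y) (t : ℝ) (x : EuclideanSpace ℝ (Fin m)) :
    Y (t • x) = t ^ k • Y x := by
  obtain ⟨c, hc⟩ := hY.homogeneous_polynomial
  rw [hc, hc, Finset.smul_sum]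
  refine Finset.sum_congr rfl fun s hs => ?_
  rw [Finset.mem_piAntidiag] at hs
  simp [mul_pow, Finset.prod_mul_distrib, Finset.prod_pow_eq_pow_sum, hs.1, smul_smul]

/-- Euler's identity for homogeneous polynomials. -/
theorem fderiv_apply_self (hY : IsInnerSphericalMonogenic k Y) (x : EuclideanSpace ℝ (Fin m)) :
    fderiv ℝ Y x x = (k : ℝ) • Y x := by
  have hline : HasDerivAt (fun t : ℝ => t • x) x 1 := by
    simpa using (hasDerivAt_id (1 : ℝ)).smul_const x
  have hY1 : HasFDerivAt Y (fderiv ℝ Y x) ((1 : ℝ) • x) := by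
    simpa using (hY.differentiable x).hasFDerivAt
  have h1 : HasDerivAt (fun t : ℝ => Y (t • x)) (fderiv ℝ Y x x) 1 :=
    hY1.comp_hasDerivAt (1 : ℝ) hline
  have h2 : HasDerivAt (fun t : ℝ => Y (t • x)) ((k : ℝ) • Y x) 1 := by
    simp only [hY.smul_apply]
    simpa using (hasDerivAt_pow k (1 : ℝ)).smul_const (Y x)
  exact h1.unique h2

theorem differentiable_vec_mul (hY : IsInnerSphericalMonogenic k Y) :
    Differentiable ℝ fun y => vec y * Y y := fun x =>
  ((mulCLM m).hasFDerivAt_of_bilinear (vecCLM m).hasFDerivAt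
    (hY.differentiable x).hasFDerivAt).differentiableAt

/-- Euler's identity turns -m - 2E into -m - 2k = -2μ; this is where μ enters. -/
theorem dirac_vec_mul (hY : IsInnerSphericalMonogenic k Y) (x : EuclideanSpace ℝ (Fin m)) :
    dirac (fun y => vec y * Y y) x = (-2 * ((k : ℝ) + (m : ℝ) / 2)) • Y x := by
  rw [CliffordGegenbauer.dirac_vec_mul (hY.differentiable x), hY.monogenic, hY.fderiv_apply_self,
    mul_zero, sub_zero]
  module

theorem dirac_radial_smul (hY : IsInnerSphericalMonogenic k Y) {h : ℝ → ℝ} {h' : ℝ}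
    (hh : HasDerivAt h h' (‖x‖ ^ 2)) :
    dirac (fun y => h (‖y‖ ^ 2) • Y y) x = (2 * h') • (vec x * Y x) := by
  rw [CliffordGegenbauer.dirac_radial_smul hh (hY.differentiable x), hY.monogenic, smul_zero,
    add_zero]

/-- Since x·x = -|x|² is scalar, the result is again a radial multiple of Y. -/
theorem dirac_radial_smul_vec_mul (hY : IsInnerSphericalMonogenic k Y) {h : ℝ → ℝ} {h' : ℝ}
    (hh : HasDerivAt h h' (‖x‖ ^ 2)) :
    dirac (fun y => h (‖y‖ ^ 2) • (vec y * Y y)) x =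
      (-2 * (‖x‖ ^ 2 * h' + ((k : ℝ) + (m : ℝ) / 2) * h (‖x‖ ^ 2))) • Y x := by
  rw [CliffordGegenbauer.dirac_radial_smul hh (hY.differentiable_vec_mul x), hY.dirac_vec_mul,
    ← mul_assoc, vec_mul_self, ← Algebra.smul_def]
  module

end IsInnerSphericalMonogenic
end CliffordGegenbauer

/-! ### Polynomial identities for the Gamma sums. -/

namespace CliffordGegenbauer

section Polynomials

open Polynomial

/-- The polynomial `∑ l ≤ N, (N choose l) (Γ(l + b) / Γ(l + a)) (-1)^l X^l`. -/
noncomputable def gammaPoly (N : ℕ) (a b : ℝ) : ℝ[X] :=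
  ∑ l ∈ Finset.range (N + 1),
    monomial l ((N.choose l : ℝ) * (Real.Gamma (l + b) / Real.Gamma (l + a)) * (-1) ^ l)

theorem eval_gammaPoly (N : ℕ) (a b s : ℝ) :
    (gammaPoly N a b).eval s = ∑ l ∈ Finset.range (N + 1),
      (N.choose l : ℝ) * (Real.Gamma (l + b) / Real.Gamma (l + a)) * (-1) ^ l * s ^ l := by
  simp [gammaPoly, eval_finsetSum]

theorem coeff_gammaPoly (N : ℕ) (a b : ℝ) (l : ℕ) :
    (gammaPoly N a b).coeff l =
      (N.choose l : ℝ) * (Real.Gamma (l + b) / Real.Gamma (l + a)) * (-1) ^ l := by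
  simp only [gammaPoly, finsetSum_coeff, coeff_monomial, Finset.sum_ite_eq', Finset.mem_range]
  split_ifs with h
  · rfl
  · rw [Nat.choose_eq_zero_of_lt (by omega)]
    simp

/-- Both sides vanish for l > N, so coefficients can be compared for all l without splitting at the
degree. -/
theorem cast_choose_succ_mul (N l : ℕ) :
    (N.choose (l + 1) : ℝ) * (l + 1) = N.choose l * (N - l) := by
  rcases le_or_gt l N with hl | hl
  · rw [← Nat.cast_sub hl]
    exact_mod_cast Nat.choose_succ_right_eq N l
  · simp [Nat.choose_eq_zero_of_lt hl, Nat.choose_eq_zero_of_lt (hl.trans (Nat.lt_succ_self l))]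

theorem coeff_X_mul_derivative (P : ℝ[X]) (l : ℕ) :
    (X * derivative P).coeff l = l * P.coeff l := by
  cases l with
  | zero => simp
  | succ l => rw [coeff_X_mul, coeff_derivative]; push_cast; ring

/-- With b = μ+N+α+1, the coefficients of X^l agree because (N-l)(l+b) + (l+α+1)(l+μ) =
(α+N+1)(μ+N): the dependence on l cancels. -/
theorem derivative_gammaPoly_even (N : ℕ) {α μ : ℝ} (hμ : 0 < μ) (h : 0 < μ + N + α + 1) :
    (1 - X) * derivative (gammaPoly N μ (μ + N + (α + 1))) -
        C (α + 1) * gammaPoly N μ (μ + N + (α + 1)) =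
      C (-((α + N + 1) * (μ + N))) * gammaPoly N (μ + 1) (μ + N + 1 + α) := by
  ext l
  have hc := cast_choose_succ_mul N l
  have hl : (0 : ℝ) ≤ l := l.cast_nonneg
  have hlμ : (l : ℝ) + μ ≠ 0 := by positivity
  have hla : (l : ℝ) + (μ + N + (α + 1)) ≠ 0 := by
    have : 0 < (l : ℝ) + (μ + N + (α + 1)) := by linarith
    exact this.ne'
  have hG : Real.Gamma (l + μ) ≠ 0 := (Real.Gamma_pos_of_pos (by positivity)).ne'
  have e1 : Real.Gamma (l + (μ + 1)) = (l + μ) * Real.Gamma (l + μ) := by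
    rw [← Real.Gamma_add_one hlμ]; ring_nf
  have e2 : Real.Gamma ((l + 1 : ℕ) + μ) = (l + μ) * Real.Gamma (l + μ) := by
    rw [← Real.Gamma_add_one hlμ]; push_cast; ring_nf
  have e3 : Real.Gamma ((l + 1 : ℕ) + (μ + N + (α + 1))) =
      (l + (μ + N + (α + 1))) * Real.Gamma (l + (μ + N + (α + 1))) := by
    rw [← Real.Gamma_add_one hla]; push_cast; ring_nf
  have e4 : Real.Gamma (l + (μ + N + 1 + α)) = Real.Gamma (l + (μ + N + (α + 1))) := by ring_nf
  simp only [sub_mul, one_mul, coeff_sub, coeff_C_mul, coeff_X_mul_derivative, coeff_derivative]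
  simp only [coeff_gammaPoly, e1, e2, e3, e4]
  generalize Real.Gamma (l + (μ + N + (α + 1))) = g
  generalize Real.Gamma (l + μ) = d at hG
  field_simp
  rw [pow_succ]
  linear_combination (-g * (l + (μ + N + (α + 1))) * (-1) ^ l) * hc

/-- The multiplication by X raises the degree; Pascal's rule supplies the binomials of N+1, and the
Gamma recurrence the rest. -/
theorem derivative_gammaPoly_odd (N : ℕ) {α μ : ℝ} (hμ : 0 < μ) (h : 0 < μ + N + α + 1) :
    X * ((1 - X) * derivative (gammaPoly N (μ + 1) (μ + N + 1 + (α + 1))) -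
        C (α + 1) * gammaPoly N (μ + 1) (μ + N + 1 + (α + 1))) +
        C μ * ((1 - X) * gammaPoly N (μ + 1) (μ + N + 1 + (α + 1))) =
      C (μ + α + N + 1) * gammaPoly (N + 1) μ (μ + (N + 1 : ℕ) + α) := by
  set P := gammaPoly N (μ + 1) (μ + N + 1 + (α + 1)) with hP
  have e1 : ∀ l : ℕ, Real.Gamma (l + (μ + 1)) = (l + μ) * Real.Gamma (l + μ) := fun l => by
    rw [← Real.Gamma_add_one (by positivity)]; ring_nf
  have hpos : ∀ l : ℕ, 0 < (l : ℝ) + (μ + N + 1 + α) := fun l => by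
    have : (0 : ℝ) ≤ l := l.cast_nonneg
    linarith
  have e2 : ∀ l : ℕ, Real.Gamma (l + (μ + N + 1 + (α + 1))) =
      (l + (μ + N + 1 + α)) * Real.Gamma (l + (μ + N + 1 + α)) := fun l => by
    rw [← Real.Gamma_add_one (hpos l).ne']; ring_nf
  have hG : ∀ l : ℕ, Real.Gamma (l + μ) ≠ 0 := fun l =>
    (Real.Gamma_pos_of_pos (by positivity)).ne'
  -- Expanded so that every term is a scalar multiple of P, XP, XP' or X(XP'), whose coefficients
  -- are known.
  have key : X * ((1 - X) * derivative P - C (α + 1) * P) + C μ * ((1 - X) * P) =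
      X * derivative P - X * (X * derivative P) - C (α + 1) * (X * P) + C μ * P -
        C μ * (X * P) := by ring
  rw [key]
  ext l
  cases l with
  | zero =>
    have := hG 0
    simp only [coeff_sub, coeff_add, coeff_C_mul, coeff_X_mul_zero, hP, coeff_gammaPoly, e1, e2]
    have e3 : Real.Gamma ((0 : ℕ) + (μ + (N + 1 : ℕ) + α)) =
        Real.Gamma ((0 : ℕ) + (μ + N + 1 + α)) := by push_cast; ring_nf
    rw [e3]
    simp at this ⊢
    field_simp
    ring
  | succ l =>
    have h0 := hG l
    have h1 := hG (l + 1)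
    have e3 : Real.Gamma ((l + 1 : ℕ) + (μ + (N + 1 : ℕ) + α)) =
        (l + (μ + N + 1 + α)) * Real.Gamma (l + (μ + N + 1 + α)) := by
      rw [← Real.Gamma_add_one (hpos l).ne']; push_cast; ring_nf
    have e4 : Real.Gamma ((l + 1 : ℕ) + (μ + N + 1 + α)) =
        (l + (μ + N + 1 + α)) * Real.Gamma (l + (μ + N + 1 + α)) := by
      rw [← Real.Gamma_add_one (hpos l).ne']; push_cast; ring_nf
    have e5 : Real.Gamma ((l + 1 : ℕ) + μ) = (l + μ) * Real.Gamma (l + μ) := by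
      rw [← Real.Gamma_add_one (by positivity)]; push_cast; ring_nf
    have hc1 : (((N + 1).choose (l + 1) : ℕ) : ℝ) = N.choose l + N.choose (l + 1) := by
      exact_mod_cast Nat.choose_succ_succ N l
    have hc2 := cast_choose_succ_mul N l
    have hlμ : (l : ℝ) + μ ≠ 0 := by positivity
    have hlμ' : (l : ℝ) + 1 + μ ≠ 0 := by positivity
    rw [coeff_sub, coeff_add, coeff_sub, coeff_sub, coeff_C_mul, coeff_C_mul, coeff_C_mul,
      coeff_C_mul, coeff_X_mul_derivative, coeff_X_mul (X * derivative P), coeff_X_mul P,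
      coeff_X_mul_derivative]
    simp only [hP, coeff_gammaPoly, e1, e2, e3, e4, e5, hc1]
    generalize Real.Gamma (l + (μ + N + 1 + α)) = g
    generalize Real.Gamma (l + μ) = d at h0
    push_cast
    field_simp
    rw [pow_succ]
    linear_combination (-g * (-1) ^ l * (l + 1 + μ) * (l + 1 + μ + N + α)) * hc2

end Polynomials
end CliffordGegenbauer

/-! ### The one-step recursion, raising n and lowering α. -/

namespace CliffordGegenbauer
variable {m : ℕ} {k : ℕ} {Y : EuclideanSpace ℝ (Fin m) → RealClifford m}

theorem one_sub_norm_sq_pos {x : EuclideanSpace ℝ (Fin m)} (hx : ‖x‖ < 1) : 0 < 1 - ‖x‖ ^ 2 := by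
  nlinarith [norm_nonneg x]

theorem iterate_dirac_eq_smul_cgp (α : ℝ) (n : ℕ) {x : EuclideanSpace ℝ (Fin m)} (hx : ‖x‖ < 1) :
    (dirac^[n] fun y => (1 - ‖y‖ ^ 2) ^ (α + n) • Y y) x = (1 - ‖x‖ ^ 2) ^ α • cgp α n Y x := by
  have h := one_sub_norm_sq_pos hx
  rw [cgp, smul_smul, ← Real.rpow_add h, add_neg_cancel, Real.rpow_zero, one_smul]

theorem cgp_succ (α : ℝ) (n : ℕ) {g : EuclideanSpace ℝ (Fin m) → RealClifford m}
    (hg : ∀ y, ‖y‖ < 1 → cgp (α + 1) n Y y = g y) {x : EuclideanSpace ℝ (Fin m)} (hx : ‖x‖ < 1) :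
    cgp α (n + 1) Y x =
      (1 - ‖x‖ ^ 2) ^ (-α) • dirac (fun y => (1 - ‖y‖ ^ 2) ^ (α + 1) • g y) x := by
  have hα : α + ((n + 1 : ℕ) : ℝ) = α + 1 + n := by push_cast; ring
  rw [cgp, Function.iterate_succ_apply', hα]
  congr 1
  refine dirac_congr ?_
  -- The Dirac operator sees only the germ at x, and the ball is open.
  filter_upwards [continuous_norm.continuousAt.eventually_lt continuousAt_const hx] with y hy
  rw [iterate_dirac_eq_smul_cgp _ _ hy, hg y hy]

open Polynomial

/-- Factoring out (1-s)^α leaves a polynomial and prepares the cancellation with the outer weight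
(1-s)^(-α). -/
theorem hasDerivAt_rpow_mul_eval (α : ℝ) (P : ℝ[X]) {s : ℝ} (hs : 0 < 1 - s) :
    HasDerivAt (fun t => (1 - t) ^ (α + 1) * P.eval t)
      ((1 - s) ^ α * ((1 - X) * derivative P - C (α + 1) * P).eval s) s := by
  have h1 : HasDerivAt (fun t : ℝ => 1 - t) (-1) s := by
    simpa using (hasDerivAt_id s).const_sub 1
  refine ((h1.rpow_const (p := α + 1) (Or.inl hs.ne')).mul (P.hasDerivAt s)).congr_deriv ?_
  rw [add_sub_cancel_right, Real.rpow_add_one hs.ne']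
  simp
  ring

namespace IsInnerSphericalMonogenic

theorem cgp_succ_of_even (hY : IsInnerSphericalMonogenic k Y) (α : ℝ) (n : ℕ) (P : ℝ[X])
    (hP : ∀ y, ‖y‖ < 1 → cgp (α + 1) n Y y = P.eval (‖y‖ ^ 2) • Y y)
    {x : EuclideanSpace ℝ (Fin m)} (hx : ‖x‖ < 1) :
    cgp α (n + 1) Y x =
      (2 * ((1 - X) * derivative P - C (α + 1) * P).eval (‖x‖ ^ 2)) • (vec x * Y x) := by
  have hs := one_sub_norm_sq_pos hx
  rw [cgp_succ α n hP hx]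
  simp only [smul_smul]
  rw [hY.dirac_radial_smul (hasDerivAt_rpow_mul_eval α P hs), smul_smul, Real.rpow_neg hs.le]
  have := (Real.rpow_pos_of_pos hs α).ne'
  congr 1
  field_simp

theorem cgp_succ_of_odd (hY : IsInnerSphericalMonogenic k Y) (α : ℝ) (n : ℕ) (P : ℝ[X])
    (hP : ∀ y, ‖y‖ < 1 → cgp (α + 1) n Y y = P.eval (‖y‖ ^ 2) • (vec y * Y y))
    {x : EuclideanSpace ℝ (Fin m)} (hx : ‖x‖ < 1) :
    cgp α (n + 1) Y x =
      (-2 * (X * ((1 - X) * derivative P - C (α + 1) * P) +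
        C ((k : ℝ) + (m : ℝ) / 2) * ((1 - X) * P)).eval (‖x‖ ^ 2)) • Y x := by
  have hs := one_sub_norm_sq_pos hx
  rw [cgp_succ α n hP hx]
  simp only [smul_smul]
  rw [hY.dirac_radial_smul_vec_mul (hasDerivAt_rpow_mul_eval α P hs), smul_smul,
    Real.rpow_neg hs.le, Real.rpow_add_one hs.ne']
  have := (Real.rpow_pos_of_pos hs α).ne'
  congr 1
  simp only [eval_add, eval_mul, eval_X, eval_C, eval_sub, eval_one]
  field_simp

end IsInnerSphericalMonogenic
end CliffordGegenbauer

/-! ### Constants and induction. -/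

namespace CliffordGegenbauer.IsInnerSphericalMonogenic
open Polynomial
variable {m k : ℕ} {Y : EuclideanSpace ℝ (Fin m) → RealClifford m}

/-- The new factor -2(α+N+1)(μ+N) is absorbed by Γ(α+N+2) in the denominator and Γ(μ+N) in the
numerator. -/
theorem cgp_odd_of_even (hY : IsInnerSphericalMonogenic k Y) (N : ℕ) {α μ : ℝ} (hα : -1 < α)
    (hμ : 1 / 2 ≤ μ)
    (h : ∀ y, ‖y‖ < 1 → cgp (α + 1) (2 * N) Y y =
      (C ((2 : ℝ) ^ (2 * N) * Real.Gamma (α + 1 + 2 * N + 1) * Real.Gamma (μ + N) /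
        (Real.Gamma (α + 1 + N + 1) * Real.Gamma (μ + N + (α + 1)))) *
          gammaPoly N μ (μ + N + (α + 1))).eval (‖y‖ ^ 2) • Y y)
    {x : EuclideanSpace ℝ (Fin m)} (hx : ‖x‖ < 1) :
    cgp α (2 * N + 1) Y x =
      (C (-((2 : ℝ) ^ (2 * N + 1) * Real.Gamma (α + 2 * N + 2) * Real.Gamma (μ + N + 1) /
        (Real.Gamma (α + N + 1) * Real.Gamma (μ + N + α + 1)))) *
          gammaPoly N (μ + 1) (μ + N + 1 + α)).eval (‖x‖ ^ 2) • (vec x * Y x) := by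
  have hN : (0 : ℝ) ≤ N := N.cast_nonneg
  have h1 : 0 < α + N + 1 := by linarith
  have h2 : 0 < μ + N + α + 1 := by linarith
  have h3 : 0 < μ + N := by linarith
  have key := derivative_gammaPoly_even N (by linarith : 0 < μ) h2
  have e1 : Real.Gamma (α + 1 + N + 1) = (α + N + 1) * Real.Gamma (α + N + 1) := by
    rw [← Real.Gamma_add_one h1.ne']; ring_nf
  have e2 : Real.Gamma (μ + N + 1) = (μ + N) * Real.Gamma (μ + N) := Real.Gamma_add_one h3.ne'
  have e3 : α + 1 + 2 * (N : ℝ) + 1 = α + 2 * N + 2 := by ring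
  have e4 : μ + N + (α + 1) = μ + N + α + 1 := by ring
  rw [hY.cgp_succ_of_even α (2 * N) _ h hx]
  congr 1
  rw [derivative_C_mul, mul_left_comm, mul_left_comm (C (α + 1)), ← mul_sub, key, e1, e2, e3, e4]
  simp only [eval_mul, eval_C]
  have g1 := (Real.Gamma_pos_of_pos h1).ne'
  have g2 := (Real.Gamma_pos_of_pos h2).ne'
  generalize Real.Gamma (α + N + 1) = a at *
  generalize Real.Gamma (μ + N + α + 1) = b at *
  generalize Real.Gamma (α + 2 * N + 2) = c at *
  generalize Real.Gamma (μ + N) = d at *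
  field_simp
  ring

/-- The factor μ+α+N+1 cancels against Γ(μ+N+α+2), and -2 restores the positive sign. -/
theorem cgp_even_of_odd (hY : IsInnerSphericalMonogenic k Y) (N : ℕ) {α μ : ℝ} (hα : -1 < α)
    (hμ : 1 / 2 ≤ μ) (hkμ : μ = (k : ℝ) + (m : ℝ) / 2)
    (h : ∀ y, ‖y‖ < 1 → cgp (α + 1) (2 * N + 1) Y y =
      (C (-((2 : ℝ) ^ (2 * N + 1) * Real.Gamma (α + 1 + 2 * N + 2) * Real.Gamma (μ + N + 1) /
        (Real.Gamma (α + 1 + N + 1) * Real.Gamma (μ + N + (α + 1) + 1)))) *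
          gammaPoly N (μ + 1) (μ + N + 1 + (α + 1))).eval (‖y‖ ^ 2) • (vec y * Y y))
    {x : EuclideanSpace ℝ (Fin m)} (hx : ‖x‖ < 1) :
    cgp α (2 * (N + 1)) Y x =
      (C ((2 : ℝ) ^ (2 * (N + 1)) * Real.Gamma (α + 2 * (N + 1 : ℕ) + 1) *
        Real.Gamma (μ + (N + 1 : ℕ)) /
        (Real.Gamma (α + (N + 1 : ℕ) + 1) * Real.Gamma (μ + (N + 1 : ℕ) + α))) *
          gammaPoly (N + 1) μ (μ + (N + 1 : ℕ) + α)).eval (‖x‖ ^ 2) • Y x := by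
  have hN : (0 : ℝ) ≤ N := N.cast_nonneg
  have h1 : 0 < α + N + 2 := by linarith
  have h2 : 0 < μ + N + α + 1 := by linarith
  have key := derivative_gammaPoly_odd N (by linarith : 0 < μ) h2
  have e1 : α + 1 + N + 1 = α + N + 2 := by ring
  have e1' : α + (N + 1 : ℕ) + 1 = α + N + 2 := by push_cast; ring
  have e2 : Real.Gamma (μ + N + (α + 1) + 1) = (μ + N + α + 1) * Real.Gamma (μ + N + α + 1) := by
    rw [← Real.Gamma_add_one h2.ne']; ring_nf
  have e2' : Real.Gamma (μ + (N + 1 : ℕ) + α) = Real.Gamma (μ + N + α + 1) := by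
    push_cast; ring_nf
  have e3 : α + 2 * ((N + 1 : ℕ) : ℝ) + 1 = α + 1 + 2 * N + 2 := by push_cast; ring
  have e4 : Real.Gamma (μ + (N + 1 : ℕ)) = Real.Gamma (μ + N + 1) := by push_cast; ring_nf
  have hn : 2 * (N + 1) = 2 * N + 1 + 1 := by ring
  rw [hn, hY.cgp_succ_of_odd α (2 * N + 1) _ h hx, ← hkμ]
  congr 1
  have hC : ∀ (c : ℝ) (P : ℝ[X]), X * ((1 - X) * derivative (C c * P) - C (α + 1) * (C c * P)) +
      C μ * ((1 - X) * (C c * P)) =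
      C c * (X * ((1 - X) * derivative P - C (α + 1) * P) + C μ * ((1 - X) * P)) := fun c P => by
    rw [derivative_C_mul]; ring
  rw [hC, key, e1, e1', e2, e2', e3, e4]
  simp only [eval_mul, eval_C]
  have g1 := (Real.Gamma_pos_of_pos h1).ne'
  have g2 := (Real.Gamma_pos_of_pos h2).ne'
  have h2' := h2.ne'
  generalize Real.Gamma (α + N + 2) = a at *
  generalize Real.Gamma (μ + N + α + 1) = b at *
  generalize Real.Gamma (α + 1 + 2 * N + 2) = c at *
  generalize Real.Gamma (μ + N + 1) = d at *
  generalize eval (‖x‖ ^ 2) _ = p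
  field_simp
  ring

theorem cgp_zero {α μ : ℝ} (hα : -1 < α) (hμ : 1 / 2 ≤ μ) (h : μ + α ≠ 0)
    {x : EuclideanSpace ℝ (Fin m)} (hx : ‖x‖ < 1) :
    cgp α 0 Y x =
      (C ((2 : ℝ) ^ (2 * 0) * Real.Gamma (α + 2 * (0 : ℕ) + 1) * Real.Gamma (μ + (0 : ℕ)) /
        (Real.Gamma (α + (0 : ℕ) + 1) * Real.Gamma (μ + (0 : ℕ) + α))) *
          gammaPoly 0 μ (μ + (0 : ℕ) + α)).eval (‖x‖ ^ 2) • Y x := by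
  have hs := one_sub_norm_sq_pos hx
  have g1 := (Real.Gamma_pos_of_pos (by linarith : 0 < α + 1)).ne'
  have g2 := (Real.Gamma_pos_of_pos (by linarith : 0 < μ)).ne'
  have g3 : Real.Gamma (μ + α) ≠ 0 := by
    -- Since μ+α > -1/2, the only pole that could be hit is 0, which is excluded by hypothesis.
    refine Real.Gamma_ne_zero fun n hn => ?_
    rcases n with _ | n
    · exact h (by simpa using hn)
    · push_cast at hn
      linarith [(n.cast_nonneg : (0 : ℝ) ≤ n)]
  have e : cgp α 0 Y x = Y x := by
    rw [cgp, Function.iterate_zero, id, smul_smul, ← Real.rpow_add hs]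
    simp
  rw [e]
  simp [eval_gammaPoly]
  field_simp
  simp

/-- The explicit form of the Clifford-Gegenbauer polynomials of even degree. -/
theorem cgp_even (hY : IsInnerSphericalMonogenic k Y) {μ : ℝ} (hμ : 1 / 2 ≤ μ)
    (hkμ : μ = (k : ℝ) + (m : ℝ) / 2) (N : ℕ) {α : ℝ} (hα : -1 < α) (h : μ + N + α ≠ 0)
    {x : EuclideanSpace ℝ (Fin m)} (hx : ‖x‖ < 1) :
    cgp α (2 * N) Y x =
      (C ((2 : ℝ) ^ (2 * N) * Real.Gamma (α + 2 * N + 1) * Real.Gamma (μ + N) /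
        (Real.Gamma (α + N + 1) * Real.Gamma (μ + N + α))) *
          gammaPoly N μ (μ + N + α)).eval (‖x‖ ^ 2) • Y x := by
  -- Two recursion steps relate N+1 at α to N at α+2, so α must vary. The side condition at α+2 is
  -- automatic, so it matters only for N = 0.
  induction N generalizing α x with
  | zero => exact cgp_zero hα hμ (by simpa using h) hx
  | succ N ih =>
    have hN : (0 : ℝ) ≤ N := N.cast_nonneg
    refine hY.cgp_even_of_odd N hα hμ hkμ (fun y hy => ?_) hx
    refine hY.cgp_odd_of_even N (by linarith) hμ (fun z hz => ?_) hy
    exact ih (by linarith) (by linarith : 0 < μ + N + (α + 1 + 1)).ne' hz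

/-- The explicit form of the Clifford-Gegenbauer polynomials of odd degree. -/
theorem cgp_odd (hY : IsInnerSphericalMonogenic k Y) {μ : ℝ} (hμ : 1 / 2 ≤ μ)
    (hkμ : μ = (k : ℝ) + (m : ℝ) / 2) (N : ℕ) {α : ℝ} (hα : -1 < α)
    {x : EuclideanSpace ℝ (Fin m)} (hx : ‖x‖ < 1) :
    cgp α (2 * N + 1) Y x =
      (C (-((2 : ℝ) ^ (2 * N + 1) * Real.Gamma (α + 2 * N + 2) * Real.Gamma (μ + N + 1) /
        (Real.Gamma (α + N + 1) * Real.Gamma (μ + N + α + 1)))) *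
          gammaPoly N (μ + 1) (μ + N + 1 + α)).eval (‖x‖ ^ 2) • (vec x * Y x) := by
  have hN : (0 : ℝ) ≤ N := N.cast_nonneg
  refine hY.cgp_odd_of_even N hα hμ (fun y hy => ?_) hx
  -- The even formula is used at α+1, where its side condition always holds; hence the odd formula
  -- needs none.
  exact hY.cgp_even hμ hkμ N (by linarith) (by linarith : 0 < μ + N + (α + 1)).ne' hy

end CliffordGegenbauer.IsInnerSphericalMonogenic

open CliffordGegenbauer

theorem mainTheorem8 (m N k : ℕ) (hm : 1 ≤ m) (α μ : ℝ) (hα : -1 < α)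
    (hμ : μ = (k : ℝ) + (m : ℝ) / 2)
    (Y : EuclideanSpace ℝ (Fin m) → RealClifford m) (hY : IsInnerSphericalMonogenic k Y)
    (x : EuclideanSpace ℝ (Fin m)) (hx : ‖x‖ < 1) :
    (μ + N + α ≠ 0 →
      cgp α (2 * N) Y x =
        ((2 : ℝ) ^ (2 * N) * Real.Gamma (α + 2 * N + 1) * Real.Gamma (μ + N) /
            (Real.Gamma (α + N + 1) * Real.Gamma (μ + N + α)) *
          ∑ l ∈ Finset.range (N + 1), (N.choose l : ℝ) *
            (Real.Gamma (l + μ + N + α) / Real.Gamma (l + μ)) * (-1) ^ l * ‖x‖ ^ (2 * l)) •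
          Y x) ∧
    cgp α (2 * N + 1) Y x =
      (-((2 : ℝ) ^ (2 * N + 1) * Real.Gamma (α + 2 * N + 2) * Real.Gamma (μ + N + 1) /
            (Real.Gamma (α + N + 1) * Real.Gamma (μ + N + α + 1))) *
          ∑ l ∈ Finset.range (N + 1), (N.choose l : ℝ) *
            (Real.Gamma (l + μ + N + 1 + α) / Real.Gamma (l + μ + 1)) * (-1) ^ l *
              ‖x‖ ^ (2 * l)) •
        (vec x * Y x) := by
  have hm' : (1 : ℝ) ≤ m := by exact_mod_cast hm
  -- With α > -1 this gives μ+α > -1/2, which keeps the shifted Gamma arguments positive.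
  have hμ' : 1 / 2 ≤ μ := by
    have : (0 : ℝ) ≤ k := k.cast_nonneg
    linarith
  constructor
  · intro h
    rw [hY.cgp_even hμ' hμ N hα h hx]
    simp only [Polynomial.eval_mul, Polynomial.eval_C, eval_gammaPoly, pow_mul, add_assoc]
  · rw [hY.cgp_odd hμ' hμ N hα hx]
    simp only [Polynomial.eval_mul, Polynomial.eval_C, eval_gammaPoly, pow_mul, add_assoc]
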